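/- Let $\Omega\subset\mathbb R^d$ ($d\ge 1$) be a bounded open set (for instance a bounded Lipschitz polytopal domain with $d\in\{1,2,3\}$), let $T>0$, $Q_T=\Omega\times(0,T)$, and let $c\in L^\infty(\Omega)$ satisfy $c(x)\ge c_0>0$ for a.e. $x\in\Omega$. Let $H^1_0(\Omega)$ be the closure of $C_c^\infty(\Omega)$ in $H^1(\Omega)$, $[H^1_0(\Omega)]'$ its dual and $\langle\cdot,\cdot\rangle_{H^1_0(\Omega)}$ the duality product. Put $$(\chi,\psi)_{L^2_e(Q_T)}=\int_0^T(\chi(\cdot,s),\psi(\cdot,s))_{L^2(\Omega)}\,e^{-s/T}\,ds,\qquad \|\chi\|_{L^2_e(Q_T)}^2=(\chi,\chi)_{L^2_e(Q_T)},$$ (likewise for vector fields), and $\langle F,\lambda\rangle_e=\int_0^T\langle F(\cdot,s),\lambda(\cdot,s)\rangle_{H^1_0(\Omega)}\,e^{-s/T}\,ds$. For $F\in[H^1_0(\Omega)]'$ let $\mathcal N^\Omega F\in H^1_0(\Omega)$ be defined by $(c^2\nabla_x\mathcal N^\Omega F,\nabla_x W)_{L^2(\Omega)}=\langle F,W\rangle_{H^1_0(\Omega)}$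 for all $W\in H^1_0(\Omega)$, let $\|F\|^2_{\mathcal N^\Omega}=\langle F,\mathcal N^\Omega F\rangle_{H^1_0(\Omega)}$, and for $F\in L^2(0,T;[H^1_0(\Omega)]')$ let $\|F\|^2_{\mathcal N^\Omega_e}=\int_0^T\|F(\cdot,s)\|^2_{\mathcal N^\Omega}\,e^{-s/T}\,ds$. With weak time derivatives, set $$\mathcal A((U,V),(\lambda,\chi))=\langle\partial_tV,\lambda\rangle_e+(c^2\nabla_xU,\nabla_x\lambda)_{L^2_e(Q_T)}-(\partial_tU,\chi)_{L^2_e(Q_T)}+(V,\chi)_{L^2_e(Q_T)},$$ $$\|(U,V)\|^2_{\mathcal V_e(Q_T)}=\|\partial_tU\|^2_{L^2_e(Q_T)}+\|\partial_tV\|^2_{\mathcal N^\Omega_e}+\|c\nabla_xU\|^2_{L^2_e(Q_T)}+\|V\|^2_{L^2_e(Q_T)}.$$ (Continuity.) For all $U\in L^2(0,T;H^1_0(\Omega))\cap H^1(0,T;L^2(\Omega))$, $V\in L^2(Q_T)\cap H^1(0,T;[H^1_0(\Omega)]')$, $\lambda\in L^2(0,T;H^1_0(\Omega))$ and $\chi\in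 L^2(Q_T)$, $$\mathcal A((U,V),(\lambda,\chi))\le\sqrt2\,\|(U,V)\|_{\mathcal V_e(Q_T)}\left(\|c\nabla_x\lambda\|^2_{L^2_e(Q_T)}+\|\chi\|^2_{L^2_e(Q_T)}\right)^{1/2}.$$ (Coercivity-like estimate.) For all $U\in H^1(0,T;H^1_0(\Omega))$ with $U(0)=0$ and all $V\in H^1(0,T;L^2(\Omega))$ with $V(0)=0$, $$\mathcal A((U,V),(\partial_tU,\partial_tV))\ge\frac1{2T}\left(\|c\nabla_xU\|^2_{L^2_e(Q_T)}+\|V\|^2_{L^2_e(Q_T)}\right).$$ -/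

import Mathlib

open MeasureTheory
open scoped ContDiff

namespace WaveST

noncomputable section

/-- `ℝ^d` with the Euclidean norm. -/
abbrev Space (d : ℕ) := EuclideanSpace ℝ (Fin d)

/-- `L²(Ω)`. -/
abbrev L2 {d : ℕ} (Ω : Set (Space d)) := Lp ℝ 2 (volume.restrict Ω)

/-- `L²(Ω; ℝ^d)`. -/
abbrev L2Vec {d : ℕ} (Ω : Set (Space d)) := Lp (Space d) 2 (volume.restrict Ω)

/-- `L²(Ω) × L²(Ω; ℝ^d)` with the norm `(‖u‖² + ‖g‖²)^(1/2)`. A function `u ∈ H¹(Ω)` is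
represented by the pair `(u, ∇u)`, so that the norm of the pair is the `H¹(Ω)` norm of `u`. -/
abbrev L2Pair {d : ℕ} (Ω : Set (Space d)) := WithLp 2 (L2 Ω × L2Vec Ω)

/-- `φ ∈ C_c^∞(Ω)`. -/
structure IsTestFunction {E : Type*} [NormedAddCommGroup E] [NormedSpace ℝ E]
    (Ω : Set E) (φ : E → ℝ) : Prop where
  smooth : ContDiff ℝ ∞ φ
  compact : HasCompactSupport φ
  support_subset : tsupport φ ⊆ Ω

theorem IsTestFunction.gradient_add {d : ℕ} {Ω : Set (Space d)} {φ ψ : Space d → ℝ}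
    (hφ : IsTestFunction Ω φ) (hψ : IsTestFunction Ω ψ) :
    gradient (φ + ψ) = gradient φ + gradient ψ := by
  funext x
  simp only [gradient, Pi.add_apply]
  rw [fderiv_add (hφ.smooth.differentiable (by simp) x)
    (hψ.smooth.differentiable (by simp) x), map_add]

theorem IsTestFunction.gradient_smul {d : ℕ} {Ω : Set (Space d)} {φ : Space d → ℝ}
    (hφ : IsTestFunction Ω φ) (a : ℝ) : gradient (a • φ) = a • gradient φ := by
  funext x
  simp only [gradient, Pi.smul_apply]
  rw [fderiv_const_smul (hφ.smooth.differentiable (by simp) x)]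
  simp

theorem gradient_zero_fun {d : ℕ} : gradient (0 : Space d → ℝ) = 0 := by
  funext x
  simp [gradient]

theorem IsTestFunction.add {E : Type*} [NormedAddCommGroup E] [NormedSpace ℝ E]
    {Ω : Set E} {φ ψ : E → ℝ} (hφ : IsTestFunction Ω φ) (hψ : IsTestFunction Ω ψ) :
    IsTestFunction Ω (φ + ψ) :=
  ⟨hφ.smooth.add hψ.smooth, hφ.compact.add hψ.compact,
    (tsupport_add φ ψ).trans (Set.union_subset hφ.support_subset hψ.support_subset)⟩

theorem IsTestFunction.smul {E : Type*} [NormedAddCommGroup E] [NormedSpace ℝ E]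
    {Ω : Set E} {φ : E → ℝ} (hφ : IsTestFunction Ω φ) (a : ℝ) : IsTestFunction Ω (a • φ) :=
  ⟨contDiff_const.smul hφ.smooth, hφ.compact.smul_left (f := fun _ => a),
    (tsupport_smul_subset_right (fun _ => a) φ).trans hφ.support_subset⟩

theorem IsTestFunction.zero {E : Type*} [NormedAddCommGroup E] [NormedSpace ℝ E]
    {Ω : Set E} : IsTestFunction Ω (0 : E → ℝ) :=
  ⟨contDiff_const, HasCompactSupport.zero, by simp [tsupport]⟩

/-- The subspace of all pairs `(φ, ∇φ)` with `φ ∈ C_c^∞(Ω)`. -/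
def testPairs {d : ℕ} (Ω : Set (Space d)) : Submodule ℝ (L2Pair Ω) where
  carrier := {p | ∃ φ : Space d → ℝ, IsTestFunction Ω φ ∧
    p.fst =ᵐ[volume.restrict Ω] φ ∧ p.snd =ᵐ[volume.restrict Ω] gradient φ}
  zero_mem' := by
    refine ⟨0, .zero, Lp.coeFn_zero _ _ _, ?_⟩
    rw [gradient_zero_fun]
    exact Lp.coeFn_zero _ _ _
  add_mem' := by
    rintro p q ⟨φ, hφ, hp1, hp2⟩ ⟨ψ, hψ, hq1, hq2⟩
    refine ⟨φ + ψ, hφ.add hψ, (Lp.coeFn_add p.fst q.fst).trans (hp1.add hq1), ?_⟩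
    rw [hφ.gradient_add hψ]
    exact (Lp.coeFn_add p.snd q.snd).trans (hp2.add hq2)
  smul_mem' := by
    rintro a p ⟨φ, hφ, hp1, hp2⟩
    refine ⟨a • φ, hφ.smul a, (Lp.coeFn_smul a p.fst).trans (hp1.const_smul a), ?_⟩
    rw [hφ.gradient_smul a]
    exact (Lp.coeFn_smul a p.snd).trans (hp2.const_smul a)

/-- `H¹₀(Ω)`, the closure of `C_c^∞(Ω)` in the `H¹(Ω)` norm; an element is the pair `(u, ∇u)`. -/
abbrev H10 {d : ℕ} (Ω : Set (Space d)) := ↥(testPairs Ω).topologicalClosure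

/-- The dual `[H¹₀(Ω)]'`. -/
abbrev H10Dual {d : ℕ} (Ω : Set (Space d)) := StrongDual ℝ (H10 Ω)

variable {d : ℕ} {Ω : Set (Space d)}

/-- The embedding `H¹₀(Ω) → L²(Ω)`. -/
def toL2 : H10 Ω →L[ℝ] L2 Ω :=
  (WithLp.fstL 2 ℝ (L2 Ω) (L2Vec Ω)).comp (testPairs Ω).topologicalClosure.subtypeL

/-- The weak gradient `∇ₓ : H¹₀(Ω) → L²(Ω; ℝ^d)`. -/
def grad : H10 Ω →L[ℝ] L2Vec Ω :=
  (WithLp.sndL 2 ℝ (L2 Ω) (L2Vec Ω)).comp (testPairs Ω).topologicalClosure.subtypeL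

/-- The embedding `L²(Ω) → [H¹₀(Ω)]'`, `⟨v, w⟩ = (v, w)_{L²(Ω)}`. -/
def toDual (v : L2 Ω) : H10Dual Ω := (innerSL ℝ v).comp toL2

/-- `(c² ∇u, ∇v)_{L²(Ω)}`. -/
def stiffness (c : Space d → ℝ) (u v : H10 Ω) : ℝ :=
  ∫ x in Ω, inner ℝ (c x ^ 2 • grad u x) (grad v x)

/-- `‖c ∇u‖²_{L²(Ω)}`. -/
def gradNormSq (c : Space d → ℝ) (u : H10 Ω) : ℝ :=
  ∫ x in Ω, ‖c x • grad u x‖ ^ 2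

open Classical in
/-- The Newton potential `N^Ω F ∈ H¹₀(Ω)` of `F ∈ [H¹₀(Ω)]'`, the solution of
`(c² ∇ N^Ω F, ∇v)_{L²(Ω)} = ⟨F, v⟩` for all `v ∈ H¹₀(Ω)`. -/
def newtonPotential (c : Space d → ℝ) (F : H10Dual Ω) : H10 Ω :=
  if h : ∃ w : H10 Ω, ∀ v : H10 Ω, stiffness c w v = F v then h.choose else 0

/-- `‖F‖²_{N^Ω} = ⟨F, N^Ω F⟩`. -/
def newtonNormSq (c : Space d → ℝ) (F : H10Dual Ω) : ℝ := F (newtonPotential c F)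

/-! ### Functions of time with values in a Banach space -/

section Time

variable {X : Type*} [NormedAddCommGroup X] [NormedSpace ℝ X]

/-- Lebesgue measure on `(0,T)`. -/
abbrev timeMeasure (T : ℝ) : Measure ℝ := volume.restrict (Set.Ioo 0 T)

/-- `u ∈ L²(0,T;X)`. -/
def MemL2Time (T : ℝ) (u : ℝ → X) : Prop := MemLp u 2 (timeMeasure T)

/-- `v` is the weak derivative of `u` on `(0,T)`. -/
def HasWeakTimeDeriv (T : ℝ) (u v : ℝ → X) : Prop :=
  ∀ φ : ℝ → ℝ, IsTestFunction (Set.Ioo 0 T) φ →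
    ∫ t in Set.Ioo 0 T, deriv φ t • u t = -∫ t in Set.Ioo 0 T, φ t • v t

/-- `u ∈ H¹(0,T;X)`. -/
def MemH1Time (T : ℝ) (u : ℝ → X) : Prop :=
  MemL2Time T u ∧ ∃ v : ℝ → X, MemL2Time T v ∧ HasWeakTimeDeriv T u v

open Classical in
/-- The weak derivative `∂ₜu` of `u ∈ H¹(0,T;X)`, unique up to a null set. -/
def timeDeriv (T : ℝ) (u : ℝ → X) : ℝ → X :=
  if h : ∃ v : ℝ → X, MemL2Time T v ∧ HasWeakTimeDeriv T u v then h.choose else fun _ => 0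

/-- `u ∈ H¹_{0,•}(0,T;X)`: `u ∈ H¹(0,T;X)` and its continuous representative vanishes at `0`. -/
def MemH1TimeZero (T : ℝ) (u : ℝ → X) : Prop :=
  MemH1Time T u ∧ ∃ w : ℝ → X, ContinuousOn w (Set.Icc 0 T) ∧ u =ᵐ[timeMeasure T] w ∧ w 0 = 0

end Time

/-- `∫₀ᵀ f(s) e^{-s/T} ds`. -/
def expIntegral (T : ℝ) (f : ℝ → ℝ) : ℝ :=
  ∫ s in Set.Ioo 0 T, f s * Real.exp (-s / T)

/-- `(χ, ψ)_{L²_e(Q_T)}`, with `L²(Q_T)` identified with `L²(0,T;L²(Ω))`. -/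
def innerE (T : ℝ) (χ ψ : ℝ → L2 Ω) : ℝ := expIntegral T fun s => inner ℝ (χ s) (ψ s)

/-- `‖χ‖²_{L²_e(Q_T)}`. -/
def normSqE (T : ℝ) (χ : ℝ → L2 Ω) : ℝ := innerE T χ χ

/-- `(c² ∇ₓU, ∇ₓW)_{L²_e(Q_T)}`. -/
def stiffnessE (c : Space d → ℝ) (T : ℝ) (U W : ℝ → H10 Ω) : ℝ :=
  expIntegral T fun s => stiffness c (U s) (W s)

/-- `‖c ∇ₓU‖²_{L²_e(Q_T)}`. -/
def gradNormSqE (c : Space d → ℝ) (T : ℝ) (U : ℝ → H10 Ω) : ℝ :=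
  expIntegral T fun s => gradNormSq c (U s)

/-- The duality pairing `⟨F, W⟩_e`. -/
def pairingE (T : ℝ) (F : ℝ → H10Dual Ω) (W : ℝ → H10 Ω) : ℝ :=
  expIntegral T fun s => F s (W s)

/-- `‖F‖²_{N^Ω_e}`. -/
def newtonNormSqE (c : Space d → ℝ) (T : ℝ) (F : ℝ → H10Dual Ω) : ℝ :=
  expIntegral T fun s => newtonNormSq c (F s)

/-- `∂ₜU` as an `L²(Ω)`-valued function, for `U` with values in `H¹₀(Ω)`. -/
def dtL2 (T : ℝ) (U : ℝ → H10 Ω) : ℝ → L2 Ω := timeDeriv T fun t => toL2 (U t)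

/-- `∂ₜV` as an `[H¹₀(Ω)]'`-valued function, for `V` with values in `L²(Ω)`. -/
def dtDual (T : ℝ) (V : ℝ → L2 Ω) : ℝ → H10Dual Ω := timeDeriv T fun t => toDual (V t)

/-- `U ∈ L²(0,T;H¹₀(Ω)) ∩ H¹(0,T;L²(Ω))` and `V ∈ L²(Q_T) ∩ H¹(0,T;[H¹₀(Ω)]')`. -/
structure MinimalRegularity (T : ℝ) (U : ℝ → H10 Ω) (V : ℝ → L2 Ω) : Prop where
  U_L2 : MemL2Time T U
  U_H1 : MemH1Time T fun t => toL2 (U t)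
  V_L2 : MemL2Time T V
  V_H1 : MemH1Time T fun t => toDual (V t)

/-- The bilinear form
`A((U,V),(λ,χ)) = ⟨∂ₜV, λ⟩_e + (c²∇U, ∇λ)_{L²_e} - (∂ₜU, χ)_{L²_e} + (V, χ)_{L²_e}`. -/
def formA (c : Space d → ℝ) (T : ℝ) (UV : (ℝ → H10 Ω) × (ℝ → L2 Ω))
    (lc : (ℝ → H10 Ω) × (ℝ → L2 Ω)) : ℝ :=
  pairingE T (dtDual T UV.2) lc.1 + stiffnessE c T UV.1 lc.1
    - innerE T (dtL2 T UV.1) lc.2 + innerE T UV.2 lc.2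

/-- `‖(U,V)‖_{V_e(Q_T)}`. -/
def normV (c : Space d → ℝ) (T : ℝ) (UV : (ℝ → H10 Ω) × (ℝ → L2 Ω)) : ℝ :=
  √(normSqE T (dtL2 T UV.1) + newtonNormSqE c T (dtDual T UV.2)
    + gradNormSqE c T UV.1 + normSqE T UV.2)

end

end WaveST

/-!
Both estimates reduce to facts about functions of time with values in a Hilbert space, once the
operator `G u = c ∇u` from `H¹₀(Ω)` to `L²(Ω; ℝ^d)` (`mulGrad`) is available: it satisfies
`(c² ∇u, ∇v) = (G u, G v)` and `‖c ∇u‖ = ‖G u‖`. By the Poincaré inequality (`norm_toL2_le`, from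
`∫ φ² = -∫ 2 x₀ φ ∂₀φ`) the form `(G u, G v)` is coercive on `H¹₀(Ω)`, so by the Lax-Milgram theorem
the Newton potential `N` exists and is a continuous linear map (`exists_newtonPotential_eq`).

For continuity, `⟨∂ₜV, λ⟩ = (G N ∂ₜV, G λ)` and `‖∂ₜV‖_N = ‖G N ∂ₜV‖`. Hence at each time the
integrand is at most `αL + βL + xχ + yχ` for the norms of the functions concerned, which is at most
`√2 (x² + α² + β² + y²)^{1/2} (L² + χ²)^{1/2}` (`add_mul_add_mul_le_sqrt`), and the Cauchy-Schwarz
inequality in time finishes the proof (`expIntegral_inner_le`).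

For coercivity, weak time derivatives commute with the embeddings of `H¹₀(Ω)` into `L²(Ω)` and of
`L²(Ω)` into the dual, so the terms `⟨∂ₜV, ∂ₜU⟩` and `(∂ₜU, ∂ₜV)` cancel and
`∫ ((G U, G ∂ₜU) + (V, ∂ₜV)) e^{-t/T}` remains (`formA_timeDeriv_eq`). By the lemma of du
Bois-Reymond (`HasWeakTimeDeriv.ae_eq_const`) a function vanishing at time `0` is the primitive of
its weak derivative, hence absolutely continuous. For such a function `Y` the identity
`(‖Y‖² e^{-t/T})' = 2 (Y, Y') e^{-t/T} - T⁻¹ ‖Y‖² e^{-t/T}` holds almost everywhere and can be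
integrated, and the value at `T` is nonnegative (`expIntegral_inner_primitive_ge`).
-/

namespace WaveST

open MeasureTheory Set Filter Topology
open scoped ContDiff

/-! ### Absolutely continuous functions with values in a Banach space -/

section Time

variable {X : Type*} [NormedAddCommGroup X]

theorem absolutelyContinuousOnInterval_of_dist_le {f : ℝ → X} {g : ℝ → ℝ} {a b : ℝ}
    (hg : AbsolutelyContinuousOnInterval g a b)
    (h : ∀ x ∈ uIcc a b, ∀ y ∈ uIcc a b, dist (f x) (f y) ≤ dist (g x) (g y)) :
    AbsolutelyContinuousOnInterval f a b := by
  rw [absolutelyContinuousOnInterval_iff] at hg ⊢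
  intro ε hε
  obtain ⟨δ, hδ, H⟩ := hg ε hε
  refine ⟨δ, hδ, fun E hE hEδ => (Finset.sum_le_sum fun i hi => ?_).trans_lt (H E hE hEδ)⟩
  exact h _ (hE.1 i hi).1 _ (hE.1 i hi).2

theorem AbsolutelyContinuousOnInterval.norm {f : ℝ → X} {a b : ℝ}
    (hf : AbsolutelyContinuousOnInterval f a b) :
    AbsolutelyContinuousOnInterval (fun x => ‖f x‖) a b := by
  rw [absolutelyContinuousOnInterval_iff] at hf ⊢
  intro ε hε
  obtain ⟨δ, hδ, H⟩ := hf ε hε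
  refine ⟨δ, hδ, fun E hE hEδ => (Finset.sum_le_sum fun i _ => ?_).trans_lt (H E hE hEδ)⟩
  rw [dist_eq_norm (f _)]
  exact abs_norm_sub_norm_le _ _

theorem intervalIntegrable_of_timeMeasure {T : ℝ} (hT : 0 ≤ T) {f : ℝ → X}
    (hf : Integrable f (timeMeasure T)) : IntervalIntegrable f volume 0 T := by
  rw [intervalIntegrable_iff_integrableOn_Ioo_of_le hT]
  exact hf

theorem MemL2Time.integrable {T : ℝ} {u : ℝ → X} (hu : MemL2Time T u) :
    Integrable u (timeMeasure T) :=
  MemLp.integrable one_le_two hu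

variable [NormedSpace ℝ X]

theorem absolutelyContinuousOnInterval_primitive {f : ℝ → X} {a b : ℝ}
    (hf : IntervalIntegrable f volume a b) :
    AbsolutelyContinuousOnInterval (fun x => ∫ t in a..x, f t) a b := by
  refine absolutelyContinuousOnInterval_of_dist_le
    (hf.norm.absolutelyContinuousOnInterval_intervalIntegral (c := a) (by simp)) ?_
  intro x hx y hy
  have hax : IntervalIntegrable f volume a x := hf.mono_set (uIcc_subset_uIcc_left hx)
  have hay : IntervalIntegrable f volume a y := hf.mono_set (uIcc_subset_uIcc_left hy)
  rw [dist_eq_norm, Real.dist_eq, intervalIntegral.integral_interval_sub_left hax hay,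
    intervalIntegral.integral_interval_sub_left hax.norm hay.norm]
  exact intervalIntegral.norm_integral_le_abs_integral_norm

/-- The fundamental theorem of calculus for absolutely continuous functions with values in a
Banach space. Differentiability almost everywhere is assumed, since it can fail for a target
without the Radon-Nikodym property. -/
theorem integral_eq_sub_of_absolutelyContinuous [CompleteSpace X] {f f' : ℝ → X} {a b : ℝ}
    (hf : AbsolutelyContinuousOnInterval f a b) (hf' : IntervalIntegrable f' volume a b)
    (h : ∀ᵐ x, x ∈ uIcc a b → HasDerivAt f (f' x) x) :
    ∫ x in a..b, f' x = f b - f a := by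
  have hac := hf.fun_sub (absolutelyContinuousOnInterval_primitive hf')
  obtain ⟨C, hC⟩ := hac.const_of_ae_hasDerivAt_zero (by
    filter_upwards [h, hf'.ae_hasDerivAt_integral] with x h1 h2 hx
    simpa using (h1 hx).fun_sub (h2 hx a (by simp)))
  have h1 := hC a (by simp)
  have h2 := hC b (by simp)
  simp only [intervalIntegral.integral_same, sub_zero] at h1
  rw [← h1] at h2
  rw [← h2]
  abel

theorem setIntegral_Ioo_eq_intervalIntegral {T : ℝ} (hT : 0 ≤ T) (f : ℝ → X) :
    ∫ t in Ioo 0 T, f t = ∫ t in (0 : ℝ)..T, f t := by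
  rw [intervalIntegral.integral_of_le hT, integral_Ioc_eq_integral_Ioo]

theorem MemL2Time.clm_comp {Y : Type*} [NormedAddCommGroup Y] [NormedSpace ℝ Y] {T : ℝ}
    {u : ℝ → X} (hu : MemL2Time T u) (L : X →L[ℝ] Y) : MemL2Time T fun t => L (u t) :=
  L.comp_memLp' hu

/-! ### Weak time derivatives -/

theorem IsTestFunction.apply_zero {T : ℝ} {φ : ℝ → ℝ} (hφ : IsTestFunction (Ioo 0 T) φ) :
    φ 0 = 0 :=
  image_eq_zero_of_notMem_tsupport fun h => lt_irrefl _ (hφ.support_subset h).1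

theorem IsTestFunction.apply_right {T : ℝ} {φ : ℝ → ℝ} (hφ : IsTestFunction (Ioo 0 T) φ) :
    φ T = 0 :=
  image_eq_zero_of_notMem_tsupport fun h => lt_irrefl _ (hφ.support_subset h).2

theorem IsTestFunction.integrable_smul {T : ℝ} {φ : ℝ → ℝ} (hφ : IsTestFunction (Ioo 0 T) φ)
    {u : ℝ → X} (hu : Integrable u (timeMeasure T)) :
    Integrable (fun t => φ t • u t) (timeMeasure T) := by
  obtain ⟨C, hC⟩ := hφ.compact.exists_bound_of_continuous hφ.smooth.continuous
  exact hu.bdd_smul C hφ.smooth.continuous.aestronglyMeasurable (.of_forall hC)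

theorem IsTestFunction.deriv {T : ℝ} {φ : ℝ → ℝ} (hφ : IsTestFunction (Ioo 0 T) φ) :
    IsTestFunction (Ioo 0 T) (deriv φ) :=
  ⟨(contDiff_infty_iff_deriv.1 hφ.smooth).2, hφ.compact.deriv,
    tsupport_deriv_subset.trans hφ.support_subset⟩

/-- A primitive of an integrable function is weakly differentiable. -/
theorem hasWeakTimeDeriv_primitive [CompleteSpace X] {T : ℝ} (hT : 0 ≤ T) {v : ℝ → X}
    (hv : Integrable v (timeMeasure T)) :
    HasWeakTimeDeriv T (fun t => ∫ s in (0 : ℝ)..t, v s) v := by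
  intro φ hφ
  have hv' := intervalIntegrable_of_timeMeasure hT hv
  have hP := absolutelyContinuousOnInterval_primitive hv'
  have hφac : AbsolutelyContinuousOnInterval φ 0 T :=
    (hφ.smooth.of_le (by simp)).contDiffOn.absolutelyContinuousOnInterval
  have i1 : IntervalIntegrable (fun t => deriv φ t • ∫ s in (0 : ℝ)..t, v s) volume 0 T :=
    (hφ.deriv.smooth.continuous.continuousOn.smul hP.continuousOn).intervalIntegrable
  have i2 := intervalIntegrable_of_timeMeasure hT (hφ.integrable_smul hv)
  have key := integral_eq_sub_of_absolutelyContinuous (hφac.fun_smul hP) (i2.add i1) (by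
    filter_upwards [hv'.ae_hasDerivAt_integral] with t ht htT
    exact (hφ.smooth.differentiable (by simp) t).hasDerivAt.fun_smul (ht htT 0 (by simp)))
  rw [intervalIntegral.integral_add i2 i1] at key
  rw [setIntegral_Ioo_eq_intervalIntegral hT, setIntegral_Ioo_eq_intervalIntegral hT,
    eq_neg_iff_add_eq_zero, add_comm, key]
  simp [hφ.apply_zero, hφ.apply_right]

/-- Weak derivatives are unique up to a null set. -/
theorem HasWeakTimeDeriv.ae_eq [CompleteSpace X] {T : ℝ} {u v w : ℝ → X}
    (hv : Integrable v (timeMeasure T)) (hw : Integrable w (timeMeasure T))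
    (huv : HasWeakTimeDeriv T u v) (huw : HasWeakTimeDeriv T u w) : v =ᵐ[timeMeasure T] w := by
  have h := isOpen_Ioo.ae_eq_zero_of_integral_contDiff_smul_eq_zero (f := v - w)
    (μ := volume) (U := Ioo 0 T) (IntegrableOn.locallyIntegrableOn (hv.sub hw)) ?_
  · rw [EventuallyEq, ae_restrict_iff' measurableSet_Ioo]
    filter_upwards [h] with t ht htT
    exact sub_eq_zero.1 (ht htT)
  · intro φ h1 h2 h3
    have hφ : IsTestFunction (Ioo 0 T) φ := ⟨h1, h2, h3⟩
    rw [← setIntegral_eq_integral_of_forall_compl_eq_zero (s := Ioo 0 T) fun t ht => by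
      rw [image_eq_zero_of_notMem_tsupport fun h => ht (h3 h), zero_smul]]
    simp only [Pi.sub_apply, smul_sub]
    rw [integral_sub (hφ.integrable_smul hv) (hφ.integrable_smul hw), sub_eq_zero]
    exact neg_injective ((huv φ hφ).symm.trans (huw φ hφ))

/-- A test function on `(0,T)` of mean zero is the derivative of a test function. -/
theorem IsTestFunction.exists_primitive {T : ℝ} {ψ : ℝ → ℝ} (hψ : IsTestFunction (Ioo 0 T) ψ)
    (h0 : ∫ t in Ioo 0 T, ψ t = 0) :
    ∃ φ, IsTestFunction (Ioo 0 T) φ ∧ _root_.deriv φ = ψ := by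
  have hc := hψ.smooth.continuous
  have hd : ∀ t, HasDerivAt (fun t => ∫ s in (0 : ℝ)..t, ψ s) (ψ t) t := fun t =>
    hc.integral_hasStrictDerivAt 0 t |>.hasDerivAt
  have hderiv : _root_.deriv (fun t => ∫ s in (0 : ℝ)..t, ψ s) = ψ := funext fun t => (hd t).deriv
  rcases (tsupport ψ).eq_empty_or_nonempty with he | hne
  · refine ⟨0, .zero, ?_⟩
    have : ψ = 0 := tsupport_eq_empty_iff.1 he
    rw [this]
    exact deriv_zero
  -- The primitive vanishes outside the smallest interval `[a,b]` containing the support.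
  obtain ⟨a, ha⟩ := hψ.compact.exists_isLeast hne
  obtain ⟨b, hb⟩ := hψ.compact.exists_isGreatest hne
  have haT := hψ.support_subset ha.1
  have hbT := hψ.support_subset hb.1
  have hT : 0 < T := haT.1.trans haT.2
  have hsupp : ∀ t, t ∉ Icc a b → ∫ s in (0 : ℝ)..t, ψ s = 0 := by
    intro t ht
    have hz : ∀ s, s ∉ Icc a b → ψ s = 0 := fun s hs =>
      image_eq_zero_of_notMem_tsupport fun h => hs ⟨ha.2 h, hb.2 h⟩
    by_cases hta : t < a
    · rw [intervalIntegral.integral_congr (g := fun _ => 0)]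
      · simp
      · intro s hs
        refine hz s fun h => ?_
        have h4 : s < a := lt_of_le_of_lt hs.2 (max_lt haT.1 hta)
        exact absurd h.1 (not_le.2 h4)
    · have htb : b < t := by
        by_contra! h
        exact ht ⟨not_lt.1 hta, h⟩
      have hi : ∀ x y, IntervalIntegrable ψ volume x y := fun x y => hc.intervalIntegrable x y
      rw [← intervalIntegral.integral_add_adjacent_intervals (hi 0 T) (hi T t),
        ← setIntegral_Ioo_eq_intervalIntegral hT.le, h0, zero_add,
        intervalIntegral.integral_congr (g := fun _ => 0)]
      · simp
      · intro s hs
        refine hz s fun h => ?_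
        have h4 : b < s := lt_of_lt_of_le (lt_min hbT.2 htb) hs.1
        exact absurd h.2 (not_le.2 h4)
  have hts : tsupport (fun t => ∫ s in (0 : ℝ)..t, ψ s) ⊆ Icc a b :=
    closure_minimal (fun t ht => by_contra fun h => ht (hsupp t h)) isClosed_Icc
  refine ⟨fun t => ∫ s in (0 : ℝ)..t, ψ s, ⟨?_, ?_, ?_⟩, hderiv⟩
  · rw [contDiff_infty_iff_deriv, hderiv]
    exact ⟨fun t => (hd t).differentiableAt, hψ.smooth⟩
  · exact HasCompactSupport.of_support_subset_isCompact isCompact_Icc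
      (subset_closure.trans hts)
  · exact hts.trans fun t ht => ⟨haT.1.trans_le ht.1, ht.2.trans_lt hbT.2⟩

theorem exists_isTestFunction_integral_eq_one {T : ℝ} (hT : 0 < T) :
    ∃ θ, IsTestFunction (Ioo 0 T) θ ∧ ∫ t in Ioo 0 T, θ t = 1 := by
  let f : ContDiffBump (T / 2) := ⟨T / 8, T / 4, by positivity, by linarith⟩
  have hsub : tsupport (f.normed volume) ⊆ Ioo 0 T := by
    rw [f.tsupport_normed_eq, Real.closedBall_eq_Icc]
    intro t ht
    have h1 : T / 2 - T / 4 ≤ t := ht.1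
    have h2 : t ≤ T / 2 + T / 4 := ht.2
    constructor <;> linarith
  refine ⟨f.normed volume, ⟨f.contDiff_normed, f.hasCompactSupport_normed, hsub⟩, ?_⟩
  rw [setIntegral_eq_integral_of_forall_compl_eq_zero fun t ht =>
    image_eq_zero_of_notMem_tsupport fun h => ht (hsub h), f.integral_normed]

/-- The lemma of du Bois-Reymond: a function with vanishing weak derivative is constant. -/
theorem HasWeakTimeDeriv.ae_eq_const [CompleteSpace X] {T : ℝ} (hT : 0 < T) {u : ℝ → X}
    (hu : Integrable u (timeMeasure T)) (h : HasWeakTimeDeriv T u fun _ => 0) :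
    ∃ k : X, u =ᵐ[timeMeasure T] fun _ => k := by
  obtain ⟨θ, hθ, hθ1⟩ := exists_isTestFunction_integral_eq_one hT
  refine ⟨∫ t in Ioo 0 T, θ t • u t, ?_⟩
  set k := ∫ t in Ioo 0 T, θ t • u t
  have hk : Integrable (fun _ : ℝ => k) (timeMeasure T) := integrable_const k
  have hz := isOpen_Ioo.ae_eq_zero_of_integral_contDiff_smul_eq_zero (f := fun t => u t - k)
    (μ := volume) (U := Ioo 0 T) (IntegrableOn.locallyIntegrableOn (hu.sub hk)) ?_
  · rw [EventuallyEq, ae_restrict_iff' measurableSet_Ioo]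
    filter_upwards [hz] with t ht htT
    exact sub_eq_zero.1 (ht htT)
  · intro ψ h1 h2 h3
    have hψ : IsTestFunction (Ioo 0 T) ψ := ⟨h1, h2, h3⟩
    have hψi : Integrable ψ (timeMeasure T) :=
      (hψ.smooth.continuous.integrable_of_hasCompactSupport hψ.compact).restrict
    have hθi : Integrable θ (timeMeasure T) :=
      (hθ.smooth.continuous.integrable_of_hasCompactSupport hθ.compact).restrict
    set m := ∫ t in Ioo 0 T, ψ t
    -- Subtracting a multiple of `θ` gives a test function of mean zero.
    obtain ⟨φ, hφ, hφd⟩ := (hψ.add (hθ.smul (-m))).exists_primitive (by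
      simp only [Pi.add_apply, Pi.smul_apply]
      rw [integral_add hψi (by exact hθi.smul (-m)), integral_smul, hθ1]
      simp [m])
    have h5 := h φ hφ
    simp only [hφd, Pi.add_apply, Pi.smul_apply, smul_zero, integral_zero, neg_zero, add_smul,
      smul_assoc] at h5
    rw [integral_add (hψ.integrable_smul hu) (by exact (hθ.integrable_smul hu).smul (-m)),
      integral_smul] at h5
    rw [← setIntegral_eq_integral_of_forall_compl_eq_zero (s := Ioo 0 T) fun t ht => by
      rw [image_eq_zero_of_notMem_tsupport fun h => ht (h3 h), zero_smul]]
    simp only [smul_sub]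
    rw [integral_sub (hψ.integrable_smul hu) (hψ.integrable_smul hk), integral_smul_const]
    simpa [sub_eq_add_neg] using h5

/-- A weakly differentiable function whose continuous representative vanishes at `0` is the
primitive of its weak derivative. -/
theorem HasWeakTimeDeriv.eq_primitive [CompleteSpace X] {T : ℝ} (hT : 0 < T) {u v w : ℝ → X}
    (hu : Integrable u (timeMeasure T)) (hv : Integrable v (timeMeasure T))
    (h : HasWeakTimeDeriv T u v) (hw : ContinuousOn w (Icc 0 T)) (huw : u =ᵐ[timeMeasure T] w)
    (hw0 : w 0 = 0) : u =ᵐ[timeMeasure T] fun t => ∫ s in (0 : ℝ)..t, v s := by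
  have hPc : ContinuousOn (fun t => ∫ s in (0 : ℝ)..t, v s) (Icc 0 T) := by
    simpa [uIcc_of_le hT.le] using (absolutelyContinuousOnInterval_primitive
      (intervalIntegrable_of_timeMeasure hT.le hv)).continuousOn
  have hPi : Integrable (fun t => ∫ s in (0 : ℝ)..t, v s) (timeMeasure T) :=
    (hPc.integrableOn_Icc).mono_set Ioo_subset_Icc_self
  obtain ⟨k, hk⟩ := HasWeakTimeDeriv.ae_eq_const hT (hu.sub hPi) (fun φ hφ => by
    simp only [Pi.sub_apply, smul_sub]
    rw [integral_sub (hφ.deriv.integrable_smul hu) (hφ.deriv.integrable_smul hPi), h φ hφ,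
      hasWeakTimeDeriv_primitive hT.le hv φ hφ]
    simp)
  have hwk : (fun t => w t - ∫ s in (0 : ℝ)..t, v s) =ᵐ[volume.restrict (Icc 0 T)]
      fun _ => k := by
    rw [← restrict_Ioo_eq_restrict_Icc]
    filter_upwards [hk, huw] with t h1 h2
    rw [← h2]
    exact h1
  have hk0 : k = 0 := by
    have := Measure.eqOn_Icc_of_ae_eq volume hT.ne hwk (hw.sub hPc) continuousOn_const
      (left_mem_Icc.2 hT.le)
    simpa [hw0] using this.symm
  filter_upwards [hk] with t ht
  rw [hk0] at ht
  exact sub_eq_zero.1 ht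

theorem MemH1Time.timeDeriv_spec {T : ℝ} {u : ℝ → X} (hu : MemH1Time T u) :
    MemL2Time T (timeDeriv T u) ∧ HasWeakTimeDeriv T u (timeDeriv T u) := by
  rw [timeDeriv, dif_pos hu.2]
  exact hu.2.choose_spec

theorem MemH1TimeZero.ae_eq_primitive [CompleteSpace X] {T : ℝ} (hT : 0 < T) {u : ℝ → X}
    (hu : MemH1TimeZero T u) :
    u =ᵐ[timeMeasure T] fun t => ∫ s in (0 : ℝ)..t, timeDeriv T u s := by
  obtain ⟨h1, w, hw, huw, hw0⟩ := hu
  exact h1.timeDeriv_spec.2.eq_primitive hT h1.1.integrable h1.timeDeriv_spec.1.integrable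
    hw huw hw0

/-- Weak derivatives commute with continuous linear maps. -/
theorem MemH1Time.timeDeriv_clm_comp [CompleteSpace X] {Y : Type*} [NormedAddCommGroup Y]
    [NormedSpace ℝ Y] [CompleteSpace Y] {T : ℝ} {u : ℝ → X} (hu : MemH1Time T u)
    (L : X →L[ℝ] Y) :
    timeDeriv T (fun t => L (u t)) =ᵐ[timeMeasure T] fun t => L (timeDeriv T u t) := by
  have hL : MemL2Time T fun t => L (timeDeriv T u t) := hu.timeDeriv_spec.1.clm_comp L
  have hw : HasWeakTimeDeriv T (fun t => L (u t)) fun t => L (timeDeriv T u t) := by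
    intro φ hφ
    simp only [← map_smul]
    rw [L.integral_comp_comm (hφ.deriv.integrable_smul hu.1.integrable),
      L.integral_comp_comm (hφ.integrable_smul hu.timeDeriv_spec.1.integrable),
      hu.timeDeriv_spec.2 φ hφ, map_neg]
  have hH1 : MemH1Time T fun t => L (u t) := ⟨hu.1.clm_comp L, _, hL, hw⟩
  exact hH1.timeDeriv_spec.2.ae_eq hH1.timeDeriv_spec.1.integrable hL.integrable hw

end Time

/-! ### The weighted energy inequality -/

/-- Testing a primitive `Y` against its derivative with the weight `e^{-t/T}`: since
`(‖Y‖² e^{-t/T})' = 2 ⟪Y, Y'⟫ e^{-t/T} - T⁻¹ ‖Y‖² e^{-t/T}`, the decay of the weight produces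
the norm of `Y`, and the boundary term at `T` has the good sign. -/
theorem expIntegral_inner_primitive_ge {E : Type*} [NormedAddCommGroup E] [InnerProductSpace ℝ E]
    [CompleteSpace E] {T : ℝ} (hT : 0 < T) {y : ℝ → E} (hy : Integrable y (timeMeasure T)) :
    1 / (2 * T) * expIntegral T (fun t => ‖∫ s in (0 : ℝ)..t, y s‖ ^ 2) ≤
      expIntegral T fun t => inner ℝ (∫ s in (0 : ℝ)..t, y s) (y t) := by
  have hy' := intervalIntegrable_of_timeMeasure hT.le hy
  set Y : ℝ → E := fun t => ∫ s in (0 : ℝ)..t, y s with hY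
  have hYac : AbsolutelyContinuousOnInterval Y 0 T := absolutelyContinuousOnInterval_primitive hy'
  have hexp : ContDiff ℝ 1 fun t : ℝ => Real.exp (-t / T) := by fun_prop
  have hfac : AbsolutelyContinuousOnInterval (fun t => ‖Y t‖ ^ 2 * Real.exp (-t / T)) 0 T := by
    simp only [sq]
    exact ((AbsolutelyContinuousOnInterval.norm hYac).fun_mul
      (AbsolutelyContinuousOnInterval.norm hYac)).fun_mul
        hexp.contDiffOn.absolutelyContinuousOnInterval
  have i1 : IntervalIntegrable (fun t => ‖Y t‖ ^ 2 * Real.exp (-t / T)) volume 0 T :=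
    hfac.continuousOn.intervalIntegrable
  have i2 : IntervalIntegrable (fun t => inner ℝ (Y t) (y t) * Real.exp (-t / T)) volume 0 T := by
    refine IntervalIntegrable.mul_continuousOn ?_ hexp.continuous.continuousOn
    obtain ⟨C, hC⟩ := hYac.exists_bound
    rw [intervalIntegrable_iff] at hy' ⊢
    refine Integrable.mono' (hy'.norm.const_mul C) ?_ ?_
    · exact ((hYac.continuousOn.mono uIoc_subset_uIcc).aestronglyMeasurable
        measurableSet_uIoc).inner hy'.aestronglyMeasurable
    · refine (ae_restrict_iff' measurableSet_uIoc).2 (.of_forall fun t ht => ?_)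
      exact (norm_inner_le_norm _ _).trans
        (mul_le_mul_of_nonneg_right (hC t (uIoc_subset_uIcc ht)) (norm_nonneg _))
  have key := integral_eq_sub_of_absolutelyContinuous hfac
    ((i2.const_mul 2).sub (i1.const_mul (1 / T))) (by
    filter_upwards [hy'.ae_hasDerivAt_integral] with t ht htT
    have h1 := (ht htT 0 (by simp)).norm_sq
    have h2 : HasDerivAt (fun t : ℝ => Real.exp (-t / T)) (Real.exp (-t / T) * (-1 / T)) t :=
      ((hasDerivAt_id t).neg.div_const T).exp
    convert! h1.fun_mul h2 using 1
    simp only [hY]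
    ring)
  rw [intervalIntegral.integral_sub (i2.const_mul 2) (i1.const_mul (1 / T)),
    intervalIntegral.integral_const_mul, intervalIntegral.integral_const_mul] at key
  have hY0 : Y 0 = 0 := by simp [hY]
  rw [hY0] at key
  have hpos : 0 ≤ ‖Y T‖ ^ 2 * Real.exp (-T / T) := by positivity
  rw [expIntegral, expIntegral, setIntegral_Ioo_eq_intervalIntegral hT.le,
    setIntegral_Ioo_eq_intervalIntegral hT.le]
  have e : 1 / (2 * T) * (∫ t in (0 : ℝ)..T, ‖Y t‖ ^ 2 * Real.exp (-t / T)) =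
      1 / T * (∫ t in (0 : ℝ)..T, ‖Y t‖ ^ 2 * Real.exp (-t / T)) / 2 := by
    field_simp
  rw [e]
  simp only [norm_zero] at key
  linarith

/-! ### The Poincaré inequality and the Newton potential -/

section Spatial

variable {d : ℕ} {Ω : Set (Space d)}

theorem norm_sq_eq_integral {E : Type*} [NormedAddCommGroup E] [InnerProductSpace ℝ E]
    {α : Type*} [MeasurableSpace α] {μ : Measure α} (f : Lp E 2 μ) :
    ‖f‖ ^ 2 = ∫ x, ‖f x‖ ^ 2 ∂μ := by
  rw [← real_inner_self_eq_norm_sq, L2.inner_def]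
  simp only [real_inner_self_eq_norm_sq]

/-- Integration by parts of `φ²` against a coordinate function: `∫ φ² = -∫ 2 xᵢ φ ∂ᵢφ`. -/
theorem IsTestFunction.integral_sq_eq {φ : Space d → ℝ} (hφ : IsTestFunction Ω φ) (i : Fin d) :
    ∫ x, φ x ^ 2 =
      -∫ x, x i * (2 * φ x * inner ℝ (gradient φ x) (EuclideanSpace.single i 1)) := by
  have hs : ContDiff ℝ ∞ fun x => φ x ^ 2 := hφ.smooth.pow 2
  have hcs : HasCompactSupport fun x => φ x ^ 2 :=
    hφ.compact.comp_left (g := fun r : ℝ => r ^ 2) (by simp)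
  let l : Space d →L[ℝ] ℝ := EuclideanSpace.proj i
  have hl : ∀ x : Space d, fderiv ℝ (fun x : Space d => x i) x (EuclideanSpace.single i 1) = 1 := by
    intro x
    have : fderiv ℝ (fun x : Space d => x i) x = l := l.fderiv
    rw [this]
    simp [l]
  have hci : Continuous fun x : Space d => x i := l.continuous
  have hdφ : ∀ x : Space d, fderiv ℝ (fun x => φ x ^ 2) x (EuclideanSpace.single i 1) =
      2 * φ x * inner ℝ (gradient φ x) (EuclideanSpace.single i 1) := by
    intro x
    have hx := (hφ.smooth.differentiable (by simp) x).hasFDerivAt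
    rw [(hx.pow 2).fderiv]
    simp [gradient]
  have hd : Continuous fun x => fderiv ℝ (fun x => φ x ^ 2) x (EuclideanSpace.single i (1 : ℝ)) :=
    (hs.continuous_fderiv (by simp)).clm_apply continuous_const
  have hdcs : HasCompactSupport
      fun x => fderiv ℝ (fun x => φ x ^ 2) x (EuclideanSpace.single i (1 : ℝ)) :=
    hcs.fderiv_apply ℝ _
  have key := integral_mul_fderiv_eq_neg_fderiv_mul_of_integrable (μ := volume)
    (f := fun x : Space d => x i) (g := fun x => φ x ^ 2) (v := EuclideanSpace.single i (1 : ℝ))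
    (by
      simp only [hl, one_mul]
      exact hs.continuous.integrable_of_hasCompactSupport hcs)
    ((hci.mul hd).integrable_of_hasCompactSupport hdcs.mul_left)
    ((hci.mul hs.continuous).integrable_of_hasCompactSupport hcs.mul_left)
    (fun x _ => l.differentiableAt) (fun x _ => hs.differentiable (by simp) x)
  simp only [hl, one_mul, hdφ] at key
  rw [key, neg_neg]

/-- The Poincaré inequality on `H¹₀(Ω)`, for `Ω` contained in a ball of radius `R`. -/
theorem norm_toL2_le (hd : 1 ≤ d) {R : ℝ} (hR : ∀ x ∈ Ω, ‖x‖ ≤ R) (hΩ : MeasurableSet Ω)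
    (u : H10 Ω) : ‖toL2 u‖ ^ 2 ≤ 4 * R ^ 2 * ‖grad u‖ ^ 2 := by
  have hclosed : IsClosed {p : L2Pair Ω | ‖p.fst‖ ^ 2 ≤ 4 * R ^ 2 * ‖p.snd‖ ^ 2} :=
    isClosed_le (by fun_prop) (by fun_prop)
  refine closure_minimal (s := (testPairs Ω : Set (L2Pair Ω))) ?_ hclosed u.2
  rintro p ⟨φ, hφ, h1, h2⟩
  let i : Fin d := ⟨0, hd⟩
  have hi1 : Integrable (fun x => φ x ^ 2) (volume.restrict Ω) := by
    refine (Lp.memLp p.fst).integrable_sq.congr ?_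
    filter_upwards [h1] with x hx
    rw [hx]
  have hi2 : Integrable (fun x => ‖gradient φ x‖ ^ 2) (volume.restrict Ω) := by
    refine (Lp.memLp p.snd).norm.integrable_sq.congr ?_
    filter_upwards [h2] with x hx
    rw [hx]
  have e1 : ‖p.fst‖ ^ 2 = ∫ x in Ω, φ x ^ 2 := by
    rw [norm_sq_eq_integral]
    refine integral_congr_ae ?_
    filter_upwards [h1] with x hx
    rw [hx, Real.norm_eq_abs, sq_abs]
  have e2 : ‖p.snd‖ ^ 2 = ∫ x in Ω, ‖gradient φ x‖ ^ 2 := by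
    rw [norm_sq_eq_integral]
    refine integral_congr_ae ?_
    filter_upwards [h2] with x hx
    rw [hx]
  have hout : ∀ x, x ∉ Ω → φ x = 0 := fun x hx =>
    image_eq_zero_of_notMem_tsupport fun h => hx (hφ.support_subset h)
  have e3 : ∫ x in Ω, φ x ^ 2 =
      ∫ x in Ω, -(x i * (2 * φ x * inner ℝ (gradient φ x) (EuclideanSpace.single i 1))) := by
    rw [setIntegral_eq_integral_of_forall_compl_eq_zero fun x hx => by simp [hout x hx],
      setIntegral_eq_integral_of_forall_compl_eq_zero fun x hx => by simp [hout x hx],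
      hφ.integral_sq_eq i, integral_neg]
  -- Young's inequality; the first term on the right is absorbed on the left afterwards.
  have hle : ∫ x in Ω, φ x ^ 2 ≤
      ∫ x in Ω, (1 / 2 * φ x ^ 2 + 2 * R ^ 2 * ‖gradient φ x‖ ^ 2) := by
    rw [e3]
    refine (Real.le_norm_self _).trans (norm_integral_le_of_norm_le
      ((hi1.const_mul _).add (hi2.const_mul _)) ?_)
    refine (ae_restrict_iff' hΩ).2 (.of_forall fun x hx => ?_)
    have hxi : |x i| ≤ R := (PiLp.norm_apply_le x i).trans (hR x hx)
    have hin : |inner ℝ (gradient φ x) (EuclideanSpace.single i (1 : ℝ))| ≤ ‖gradient φ x‖ := by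
      simpa using abs_real_inner_le_norm (gradient φ x) (EuclideanSpace.single i (1 : ℝ))
    rw [norm_neg, Real.norm_eq_abs, abs_mul, abs_mul, abs_mul, abs_two]
    calc |x i| * (2 * |φ x| * |inner ℝ (gradient φ x) (EuclideanSpace.single i (1 : ℝ))|)
        ≤ R * (2 * |φ x| * ‖gradient φ x‖) := by gcongr; exact (abs_nonneg _).trans hxi
      _ ≤ 1 / 2 * φ x ^ 2 + 2 * R ^ 2 * ‖gradient φ x‖ ^ 2 := by
        rw [← sq_abs (φ x)]
        linarith [sq_nonneg (|φ x| - 2 * R * ‖gradient φ x‖)]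
  rw [integral_add (hi1.const_mul _) (hi2.const_mul _), integral_const_mul,
    integral_const_mul] at hle
  change ‖p.fst‖ ^ 2 ≤ 4 * R ^ 2 * ‖p.snd‖ ^ 2
  rw [e1, e2]
  linarith

/-- The operator `u ↦ c ∇u` from `H¹₀(Ω)` to `L²(Ω; ℝ^d)`. -/
noncomputable def mulGrad {c : Space d → ℝ} (hc : MemLp c ⊤ (volume.restrict Ω)) :
    H10 Ω →L[ℝ] L2Vec Ω :=
  ((ContinuousLinearMap.lsmul ℝ ℝ).holderL (volume.restrict Ω) ⊤ 2 2 (hc.toLp c)).comp grad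

variable {c : Space d → ℝ} (hc : MemLp c ⊤ (volume.restrict Ω))

theorem coeFn_mulGrad (u : H10 Ω) :
    mulGrad hc u =ᵐ[volume.restrict Ω] fun x => c x • grad u x := by
  have h := (ContinuousLinearMap.lsmul ℝ ℝ).coeFn_holder (r := 2) (hc.toLp c) (grad u)
  filter_upwards [h, hc.coeFn_toLp] with x h1 h2
  refine h1.trans ?_
  rw [h2]
  rfl

theorem stiffness_eq_inner (u v : H10 Ω) :
    stiffness c u v = inner ℝ (mulGrad hc u) (mulGrad hc v) := by
  rw [stiffness, L2.inner_def]
  refine integral_congr_ae ?_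
  filter_upwards [coeFn_mulGrad hc u, coeFn_mulGrad hc v] with x h1 h2
  rw [h1, h2, real_inner_smul_left, real_inner_smul_left, real_inner_smul_right]
  ring

theorem gradNormSq_eq_norm_sq (u : H10 Ω) : gradNormSq c u = ‖mulGrad hc u‖ ^ 2 := by
  rw [gradNormSq, norm_sq_eq_integral]
  refine integral_congr_ae ?_
  filter_upwards [coeFn_mulGrad hc u] with x h1
  rw [h1]

theorem norm_grad_le_norm_mulGrad {c₀ : ℝ} (hc₀ : 0 < c₀)
    (hcc₀ : ∀ᵐ x ∂(volume.restrict Ω), c₀ ≤ c x) (u : H10 Ω) :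
    c₀ ^ 2 * ‖grad u‖ ^ 2 ≤ ‖mulGrad hc u‖ ^ 2 := by
  rw [norm_sq_eq_integral, norm_sq_eq_integral, ← integral_const_mul]
  refine integral_mono_ae ((Lp.memLp (grad u)).norm.integrable_sq.const_mul _)
    (Lp.memLp (mulGrad hc u)).norm.integrable_sq ?_
  filter_upwards [coeFn_mulGrad hc u, hcc₀] with x h1 h2
  rw [h1, norm_smul, mul_pow, Real.norm_eq_abs, sq_abs]
  gcongr

theorem norm_sq_eq_add (u : H10 Ω) : ‖u‖ ^ 2 = ‖toL2 u‖ ^ 2 + ‖grad u‖ ^ 2 :=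
  WithLp.prod_norm_sq_eq_of_L2 (u : L2Pair Ω)

instance : CompleteSpace (H10 Ω) :=
  (testPairs Ω).isClosed_topologicalClosure.completeSpace_coe

/-- The form `(c² ∇u, ∇v)` on `H¹₀(Ω)`. -/
noncomputable def stiffnessForm {c : Space d → ℝ} (hc : MemLp c ⊤ (volume.restrict Ω)) :
    H10 Ω →L[ℝ] H10 Ω →L[ℝ] ℝ :=
  (innerSL ℝ).bilinearComp (mulGrad hc) (mulGrad hc)

theorem stiffnessForm_apply (u v : H10 Ω) :
    stiffnessForm hc u v = inner ℝ (mulGrad hc u) (mulGrad hc v) := by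
  simp [stiffnessForm]

theorem isCoercive_stiffnessForm (hd : 1 ≤ d) (hΩ : MeasurableSet Ω)
    (hΩb : Bornology.IsBounded Ω) {c₀ : ℝ} (hc₀ : 0 < c₀)
    (hcc₀ : ∀ᵐ x ∂(volume.restrict Ω), c₀ ≤ c x) : IsCoercive (stiffnessForm hc) := by
  obtain ⟨R, hR⟩ := hΩb.exists_norm_le
  refine ⟨c₀ ^ 2 / (4 * R ^ 2 + 1), by positivity, fun u => ?_⟩
  have h1 := norm_toL2_le hd hR hΩ u
  have h2 := norm_grad_le_norm_mulGrad hc hc₀ hcc₀ u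
  rw [stiffnessForm_apply, real_inner_self_eq_norm_sq, mul_assoc, ← sq,
    norm_sq_eq_add, div_mul_eq_mul_div, div_le_iff₀ (by positivity)]
  calc c₀ ^ 2 * (‖toL2 u‖ ^ 2 + ‖grad u‖ ^ 2)
      ≤ c₀ ^ 2 * (4 * R ^ 2 * ‖grad u‖ ^ 2 + ‖grad u‖ ^ 2) := by gcongr
    _ = (c₀ ^ 2 * ‖grad u‖ ^ 2) * (4 * R ^ 2 + 1) := by ring
    _ ≤ _ := by gcongr

/-- The Lax-Milgram theorem, with the solution operator as a continuous linear map on the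
dual. -/
theorem exists_solution_operator {E : Type*} [NormedAddCommGroup E] [InnerProductSpace ℝ E]
    [CompleteSpace E] {B : E →L[ℝ] E →L[ℝ] ℝ} (hB : IsCoercive B) :
    ∃ N : StrongDual ℝ E →L[ℝ] E, ∀ F v, B (N F) v = F v := by
  let r : StrongDual ℝ E →L[ℝ] E :=
    { toFun := fun F => (InnerProductSpace.toDual ℝ E).symm F
      map_add' := fun F G => map_add _ F G
      map_smul' := fun a F => by simp
      cont := (InnerProductSpace.toDual ℝ E).symm.continuous }
  refine ⟨(hB.continuousLinearEquivOfBilin.symm : E →L[ℝ] E).comp r, fun F v => ?_⟩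
  rw [← hB.continuousLinearEquivOfBilin_apply]
  simp [r]

theorem eq_of_isCoercive {E : Type*} [NormedAddCommGroup E] [InnerProductSpace ℝ E]
    [CompleteSpace E] {B : E →L[ℝ] E →L[ℝ] ℝ} (hB : IsCoercive B) {u w : E}
    (h : ∀ v, B u v = B w v) : u = w := by
  refine hB.continuousLinearEquivOfBilin.injective (ext_inner_right ℝ fun v => ?_)
  rw [hB.continuousLinearEquivOfBilin_apply, hB.continuousLinearEquivOfBilin_apply, h]

/-- The Newton potential exists, is unique and depends continuously and linearly on the
functional. In particular the default value in the definition of `newtonPotential` does not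
occur. -/
theorem exists_newtonPotential_eq (hB : IsCoercive (stiffnessForm hc)) :
    ∃ N : H10Dual Ω →L[ℝ] H10 Ω, (∀ F, newtonPotential c F = N F) ∧
      ∀ F v, inner ℝ (mulGrad hc (N F)) (mulGrad hc v) = F v := by
  obtain ⟨N, hN⟩ := exists_solution_operator hB
  refine ⟨N, fun F => ?_, fun F v => (stiffnessForm_apply hc _ v).symm.trans (hN F v)⟩
  have hex : ∃ w : H10 Ω, ∀ v : H10 Ω, stiffness c w v = F v :=
    ⟨N F, fun v => (stiffness_eq_inner hc _ v).trans
      ((stiffnessForm_apply hc _ v).symm.trans (hN F v))⟩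
  rw [newtonPotential, dif_pos hex]
  refine eq_of_isCoercive hB fun v => ?_
  exact (stiffnessForm_apply hc _ v).trans ((stiffness_eq_inner hc _ v).symm.trans
    ((hex.choose_spec v).trans (hN F v).symm))

end Spatial

/-! ### Weighted integrals in time -/

section Weighted

variable {E : Type*} [NormedAddCommGroup E] [InnerProductSpace ℝ E] {T : ℝ}

/-- Integrability with respect to `e^{-s/T} ds` on `(0,T)`. -/
def ExpIntegrable (T : ℝ) (f : ℝ → ℝ) : Prop :=
  Integrable (fun s => f s * Real.exp (-s / T)) (timeMeasure T)

theorem ExpIntegrable.add {f g : ℝ → ℝ} (hf : ExpIntegrable T f) (hg : ExpIntegrable T g) :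
    ExpIntegrable T fun s => f s + g s := by
  simp only [ExpIntegrable, add_mul]
  exact Integrable.add hf hg

theorem ExpIntegrable.sub {f g : ℝ → ℝ} (hf : ExpIntegrable T f) (hg : ExpIntegrable T g) :
    ExpIntegrable T fun s => f s - g s := by
  simp only [ExpIntegrable, sub_mul]
  exact Integrable.sub hf hg

theorem expIntegral_add {f g : ℝ → ℝ} (hf : ExpIntegrable T f) (hg : ExpIntegrable T g) :
    expIntegral T (fun s => f s + g s) = expIntegral T f + expIntegral T g := by
  simp only [expIntegral, add_mul]
  exact integral_add hf hg

theorem expIntegral_sub {f g : ℝ → ℝ} (hf : ExpIntegrable T f) (hg : ExpIntegrable T g) :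
    expIntegral T (fun s => f s - g s) = expIntegral T f - expIntegral T g := by
  simp only [expIntegral, sub_mul]
  exact integral_sub hf hg

theorem expIntegral_congr_ae {f g : ℝ → ℝ} (h : f =ᵐ[timeMeasure T] g) :
    expIntegral T f = expIntegral T g := by
  refine integral_congr_ae ?_
  filter_upwards [h] with s hs
  rw [hs]

theorem expIntegral_const_mul (a : ℝ) (f : ℝ → ℝ) :
    expIntegral T (fun s => a * f s) = a * expIntegral T f := by
  simp only [expIntegral, mul_assoc]
  exact integral_const_mul _ _

theorem expIntegral_mono {f g : ℝ → ℝ} (hf : ExpIntegrable T f) (hg : ExpIntegrable T g)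
    (h : ∀ s, f s ≤ g s) : expIntegral T f ≤ expIntegral T g :=
  integral_mono hf hg fun s => mul_le_mul_of_nonneg_right (h s) (Real.exp_pos _).le

theorem expIntegrable_of_integrable {f : ℝ → ℝ} (hT : 0 < T) (hf : Integrable f (timeMeasure T)) :
    ExpIntegrable T f := by
  refine Integrable.mul_bdd (c := 1) hf (by fun_prop) ?_
  refine (ae_restrict_iff' measurableSet_Ioo).2 (.of_forall fun t ht => ?_)
  rw [Real.norm_eq_abs, Real.abs_exp, Real.exp_le_one_iff]
  exact div_nonpos_of_nonpos_of_nonneg (neg_nonpos.2 ht.1.le) hT.le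

theorem MemL2Time.expIntegrable_inner {u v : ℝ → E} (hT : 0 < T) (hu : MemL2Time T u)
    (hv : MemL2Time T v) : ExpIntegrable T fun s => inner ℝ (u s) (v s) := by
  refine expIntegrable_of_integrable hT ?_
  refine (MemLp.integrable_mul (p := 2) (q := 2) hu.norm hv.norm).mono (hu.1.inner hv.1) ?_
  refine .of_forall fun s => ?_
  simpa [abs_mul] using norm_inner_le_norm (𝕜 := ℝ) (u s) (v s)

theorem MemL2Time.expIntegrable_norm_sq {u : ℝ → E} (hT : 0 < T) (hu : MemL2Time T u) :
    ExpIntegrable T fun s => ‖u s‖ ^ 2 := by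
  simpa only [real_inner_self_eq_norm_sq] using hu.expIntegrable_inner hT hu

theorem integrable_sqrt_mul_sqrt {α : Type*} [MeasurableSpace α] {μ : Measure α} {f g : α → ℝ}
    (hf : Integrable f μ) (hg : Integrable g μ) (hf0 : ∀ x, 0 ≤ f x) (hg0 : ∀ x, 0 ≤ g x) :
    Integrable (fun x => √(f x) * √(g x)) μ ∧
      ∫ x, √(f x) * √(g x) ∂μ ≤ √(∫ x, f x ∂μ) * √(∫ x, g x ∂μ) := by
  have aux : ∀ {h : α → ℝ}, Integrable h μ → (∀ x, 0 ≤ h x) → MemLp (fun x => √(h x)) 2 μ := by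
    intro h hh h0
    refine (memLp_two_iff_integrable_sq
      (Real.continuous_sqrt.comp_aestronglyMeasurable hh.1)).2 ?_
    simpa only [Real.sq_sqrt (h0 _)] using hh
  have hf2 := aux hf hf0
  have hg2 := aux hg hg0
  refine ⟨hf2.integrable_mul hg2, ?_⟩
  have := integral_mul_le_Lp_mul_Lq_of_nonneg Real.HolderConjugate.two_two
    (.of_forall fun x => Real.sqrt_nonneg (f x)) (.of_forall fun x => Real.sqrt_nonneg (g x))
    (by simpa using hf2) (by simpa using hg2)
  simpa only [Real.rpow_two, Real.sq_sqrt (hf0 _), Real.sq_sqrt (hg0 _),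
    ← Real.sqrt_eq_rpow] using this

/-- The Cauchy-Schwarz inequality with the weight `e^{-s/T}`. -/
theorem expIntegral_sqrt_mul_sqrt_le {f g : ℝ → ℝ}
    (hf : ExpIntegrable T f) (hg : ExpIntegrable T g) (hf0 : ∀ x, 0 ≤ f x) (hg0 : ∀ x, 0 ≤ g x) :
    ExpIntegrable T (fun s => √(f s) * √(g s)) ∧
      expIntegral T (fun s => √(f s) * √(g s)) ≤ √(expIntegral T f) * √(expIntegral T g) := by
  have h := integrable_sqrt_mul_sqrt hf hg
    (fun s => mul_nonneg (hf0 s) (Real.exp_pos _).le)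
    (fun s => mul_nonneg (hg0 s) (Real.exp_pos _).le)
  have e : ∀ s, √(f s * Real.exp (-s / T)) * √(g s * Real.exp (-s / T)) =
      √(f s) * √(g s) * Real.exp (-s / T) := by
    intro s
    rw [Real.sqrt_mul (hf0 s), Real.sqrt_mul (hg0 s)]
    have := Real.mul_self_sqrt (Real.exp_pos (-s / T)).le
    linear_combination √(f s) * √(g s) * this
  simp only [e] at h
  exact h

end Weighted

/-! ### Continuity and coercivity of the space-time form -/

section SpaceTime

variable {d : ℕ} {Ω : Set (Space d)} {c : Space d → ℝ} {T : ℝ}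

/-- `αL + βL + xχ + yχ ≤ √2 (α² + β² + x² + y²)^{1/2} (L² + χ²)^{1/2}`, by Cauchy-Schwarz in
the two summands and `(α + β)² + (x + y)² ≤ 2 (α² + β² + x² + y²)`. -/
theorem add_mul_add_mul_le_sqrt (x α β y L χ : ℝ) :
    α * L + β * L + x * χ + y * χ ≤
      √2 * (√(x ^ 2 + α ^ 2 + β ^ 2 + y ^ 2) * √(L ^ 2 + χ ^ 2)) := by
  rw [← Real.sqrt_mul (by positivity), ← Real.sqrt_mul (by norm_num)]
  refine Real.le_sqrt_of_sq_le ?_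
  nlinarith [sq_nonneg ((α + β) * χ - (x + y) * L), mul_nonneg (add_nonneg (sq_nonneg (α - β))
    (sq_nonneg (x - y))) (add_nonneg (sq_nonneg L) (sq_nonneg χ))]

/-- The continuity estimate for abstract Hilbert space valued functions: `f`, `g`, `l` stand for
`c ∇ N ∂ₜV`, `c ∇U`, `c ∇λ` and `x`, `y`, `χ` for `∂ₜU`, `V`, `χ`. -/
theorem expIntegral_inner_le {K L : Type*} [NormedAddCommGroup K] [InnerProductSpace ℝ K]
    [NormedAddCommGroup L] [InnerProductSpace ℝ L] (hT : 0 < T) {f g l : ℝ → K} {x y χ : ℝ → L}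
    (hf : MemL2Time T f) (hg : MemL2Time T g) (hl : MemL2Time T l) (hx : MemL2Time T x)
    (hy : MemL2Time T y) (hχ : MemL2Time T χ) :
    (expIntegral T fun s => inner ℝ (f s) (l s)) + (expIntegral T fun s => inner ℝ (g s) (l s))
        - (expIntegral T fun s => inner ℝ (x s) (χ s))
        + (expIntegral T fun s => inner ℝ (y s) (χ s)) ≤
      √2 * √((expIntegral T fun s => ‖x s‖ ^ 2) + (expIntegral T fun s => ‖f s‖ ^ 2)
          + (expIntegral T fun s => ‖g s‖ ^ 2) + (expIntegral T fun s => ‖y s‖ ^ 2)) *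
        √((expIntegral T fun s => ‖l s‖ ^ 2) + (expIntegral T fun s => ‖χ s‖ ^ 2)) := by
  have j1 := hf.expIntegrable_inner hT hl
  have j2 := hg.expIntegrable_inner hT hl
  have j3 := hx.expIntegrable_inner hT hχ
  have j4 := hy.expIntegrable_inner hT hχ
  have k1 := hx.expIntegrable_norm_sq hT
  have k2 := hf.expIntegrable_norm_sq hT
  have k3 := hg.expIntegrable_norm_sq hT
  have k4 := hy.expIntegrable_norm_sq hT
  have k5 := hl.expIntegrable_norm_sq hT
  have k6 := hχ.expIntegrable_norm_sq hT
  rw [← expIntegral_add j1 j2, ← expIntegral_sub (j1.add j2) j3,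
    ← expIntegral_add ((j1.add j2).sub j3) j4, ← expIntegral_add k1 k2,
    ← expIntegral_add (k1.add k2) k3, ← expIntegral_add ((k1.add k2).add k3) k4,
    ← expIntegral_add k5 k6]
  obtain ⟨hCSi, hCS⟩ := expIntegral_sqrt_mul_sqrt_le (((k1.add k2).add k3).add k4) (k5.add k6)
    (fun s => by positivity) (fun s => by positivity)
  rw [mul_assoc]
  refine le_trans ?_ (mul_le_mul_of_nonneg_left hCS (Real.sqrt_nonneg 2))
  rw [← expIntegral_const_mul]
  refine expIntegral_mono (((j1.add j2).sub j3).add j4) ?_ fun s => ?_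
  · simpa only [ExpIntegrable, mul_assoc] using Integrable.const_mul hCSi √2
  · refine le_trans ?_ (add_mul_add_mul_le_sqrt _ _ _ _ _ _)
    have l1 := real_inner_le_norm (f s) (l s)
    have l2 := real_inner_le_norm (g s) (l s)
    have l3 := (abs_le.1 (abs_real_inner_le_norm (x s) (χ s))).1
    have l4 := real_inner_le_norm (y s) (χ s)
    linarith

theorem normSqE_eq (v : ℝ → L2 Ω) : normSqE T v = expIntegral T fun s => ‖v s‖ ^ 2 := by
  simp only [normSqE, innerE, real_inner_self_eq_norm_sq]

theorem gradNormSqE_eq (hc : MemLp c ⊤ (volume.restrict Ω)) (U : ℝ → H10 Ω) :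
    gradNormSqE c T U = expIntegral T fun s => ‖mulGrad hc (U s)‖ ^ 2 := by
  simp only [gradNormSqE, gradNormSq_eq_norm_sq hc]

/-- The continuity estimate. The functional `∂ₜV` is represented by the weighted gradient of its
Newton potential, which turns the duality pairing into an inner product in `L²(Ω; ℝ^d)`. -/
theorem formA_le (hT : 0 < T) (hc : MemLp c ⊤ (volume.restrict Ω))
    (hB : IsCoercive (stiffnessForm hc)) {U : ℝ → H10 Ω} {V : ℝ → L2 Ω}
    {lam : ℝ → H10 Ω} {χ : ℝ → L2 Ω} (hUV : MinimalRegularity T U V) (hlam : MemL2Time T lam)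
    (hχ : MemL2Time T χ) :
    formA c T (U, V) (lam, χ) ≤
      √2 * normV c T (U, V) * √(gradNormSqE c T lam + normSqE T χ) := by
  obtain ⟨N, hN, hNG⟩ := exists_newtonPotential_eq hc hB
  have hdU : MemL2Time T (dtL2 T U) := hUV.U_H1.timeDeriv_spec.1
  have hdV : MemL2Time T (dtDual T V) := hUV.V_H1.timeDeriv_spec.1
  have hNV : MemL2Time T fun s => N (dtDual T V s) := 
    MemL2Time.clm_comp (X := H10Dual Ω) (Y := H10 Ω) hdV N
  have hf : MemL2Time T fun s => mulGrad hc (N (dtDual T V s)) := hNV.clm_comp _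
  have hg : MemL2Time T fun s => mulGrad hc (U s) := hUV.U_L2.clm_comp _
  have hl : MemL2Time T fun s => mulGrad hc (lam s) := hlam.clm_comp _
  have ePair : pairingE T (dtDual T V) lam = expIntegral T fun s =>
      inner ℝ (mulGrad hc (N (dtDual T V s))) (mulGrad hc (lam s)) := by
    simp only [pairingE, hNG]
  have eStiff : stiffnessE c T U lam = expIntegral T fun s =>
      inner ℝ (mulGrad hc (U s)) (mulGrad hc (lam s)) := by
    simp only [stiffnessE, stiffness_eq_inner hc]
  have eNewton : newtonNormSqE c T (dtDual T V) = expIntegral T fun s =>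
      ‖mulGrad hc (N (dtDual T V s))‖ ^ 2 := by
    simp only [newtonNormSqE, newtonNormSq, hN, ← real_inner_self_eq_norm_sq, hNG]
  have key := expIntegral_inner_le hT hf hg hl hdU hUV.V_L2 hχ
  rw [← ePair, ← eStiff, ← eNewton, ← gradNormSqE_eq, ← gradNormSqE_eq, ← normSqE_eq,
    ← normSqE_eq, ← normSqE_eq] at key
  exact key

/-- Taking `(∂ₜU, ∂ₜV)` as test functions, the two terms pairing `∂ₜU` with `∂ₜV` cancel. -/
theorem formA_timeDeriv_eq (hc : MemLp c ⊤ (volume.restrict Ω)) {U : ℝ → H10 Ω}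
    {V : ℝ → L2 Ω} (hU : MemH1Time T U) (hV : MemH1Time T V) :
    formA c T (U, V) (timeDeriv T U, timeDeriv T V) =
      (expIntegral T fun s => inner ℝ (mulGrad hc (U s)) (mulGrad hc (timeDeriv T U s))) +
        expIntegral T fun s => inner ℝ (V s) (timeDeriv T V s) := by
  have e1 : pairingE T (dtDual T V) (timeDeriv T U) =
      innerE T (dtL2 T U) (timeDeriv T V) := by
    refine expIntegral_congr_ae ?_
    -- `toDual` as a continuous linear map.
    let D : L2 Ω →L[ℝ] H10Dual Ω :=
      (ContinuousLinearMap.precomp ℝ (toL2 (Ω := Ω))).comp (innerSL ℝ)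
    filter_upwards [hV.timeDeriv_clm_comp (Y := H10Dual Ω) D, hU.timeDeriv_clm_comp toL2]
      with s h1 h2
    have h1' : dtDual T V s = toDual (timeDeriv T V s) := h1
    have h2' : dtL2 T U s = toL2 (timeDeriv T U s) := h2
    rw [h1', h2', real_inner_comm]
    rfl
  simp only [formA, e1, stiffnessE, stiffness_eq_inner hc, innerE]
  ring

theorem le_formA_timeDeriv (hT : 0 < T) (hc : MemLp c ⊤ (volume.restrict Ω)) {U : ℝ → H10 Ω}
    {V : ℝ → L2 Ω} (hU : MemH1TimeZero T U) (hV : MemH1TimeZero T V) :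
    1 / (2 * T) * (gradNormSqE c T U + normSqE T V) ≤
      formA c T (U, V) (timeDeriv T U, timeDeriv T V) := by
  have hU' := hU.1.timeDeriv_spec.1.integrable
  have hV' := hV.1.timeDeriv_spec.1.integrable
  have hGU : (fun t => mulGrad hc (U t)) =ᵐ[timeMeasure T]
      fun t => ∫ s in (0 : ℝ)..t, mulGrad hc (timeDeriv T U s) := by
    filter_upwards [hU.ae_eq_primitive hT, ae_restrict_mem measurableSet_Ioo] with t h1 ht
    rw [h1]
    refine ((mulGrad hc).intervalIntegral_comp_comm ?_).symm
    refine (intervalIntegrable_of_timeMeasure hT.le hU').mono_set ?_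
    rw [uIcc_of_le ht.1.le, uIcc_of_le hT.le]
    exact Icc_subset_Icc_right ht.2.le
  have hGV := hV.ae_eq_primitive hT
  have i1 := expIntegral_inner_primitive_ge hT ((mulGrad hc).integrable_comp hU')
  have i2 := expIntegral_inner_primitive_ge hT hV'
  have e1 : gradNormSqE c T U =
      expIntegral T fun t => ‖∫ s in (0 : ℝ)..t, mulGrad hc (timeDeriv T U s)‖ ^ 2 := by
    refine expIntegral_congr_ae ?_
    filter_upwards [hGU] with t ht
    rw [gradNormSq_eq_norm_sq hc, ht]
  have e2 : normSqE T V = expIntegral T fun t => ‖∫ s in (0 : ℝ)..t, timeDeriv T V s‖ ^ 2 := by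
    refine expIntegral_congr_ae ?_
    filter_upwards [hGV] with t ht
    rw [real_inner_self_eq_norm_sq, ht]
  have e3 : expIntegral T (fun s =>
        inner ℝ (mulGrad hc (U s)) (mulGrad hc (timeDeriv T U s))) = expIntegral T fun t =>
      inner ℝ (∫ s in (0 : ℝ)..t, mulGrad hc (timeDeriv T U s)) (mulGrad hc (timeDeriv T U t)) := by
    refine expIntegral_congr_ae ?_
    filter_upwards [hGU] with t ht
    rw [ht]
  have e4 : expIntegral T (fun s => inner ℝ (V s) (timeDeriv T V s)) = expIntegral T fun t =>
      inner ℝ (∫ s in (0 : ℝ)..t, timeDeriv T V s) (timeDeriv T V t) := by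
    refine expIntegral_congr_ae ?_
    filter_upwards [hGV] with t ht
    rw [← ht]
  rw [formA_timeDeriv_eq hc hU.1 hV.1, e1, e2, e3, e4, mul_add]
  exact add_le_add i1 i2

end SpaceTime

end WaveST

theorem mainTheorem7 {d : ℕ} (hd : 1 ≤ d) (Ω : Set (WaveST.Space d)) (hΩ : IsOpen Ω)
    (hΩb : Bornology.IsBounded Ω) (T : ℝ) (hT : 0 < T) (c : WaveST.Space d → ℝ) (c₀ : ℝ)
    (hc₀ : 0 < c₀) (hc : MemLp c ⊤ (volume.restrict Ω))
    (hcc₀ : ∀ᵐ x ∂(volume.restrict Ω), c₀ ≤ c x) :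
    (∀ (U : ℝ → WaveST.H10 Ω) (V : ℝ → WaveST.L2 Ω)
        (lam : ℝ → WaveST.H10 Ω) (χ : ℝ → WaveST.L2 Ω),
      WaveST.MinimalRegularity T U V → WaveST.MemL2Time T lam → WaveST.MemL2Time T χ →
      WaveST.formA c T (U, V) (lam, χ) ≤
        √2 * WaveST.normV c T (U, V) *
          √(WaveST.gradNormSqE c T lam + WaveST.normSqE T χ)) ∧
    (∀ (U : ℝ → WaveST.H10 Ω) (V : ℝ → WaveST.L2 Ω),
      WaveST.MemH1TimeZero T U → WaveST.MemH1TimeZero T V →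
      WaveST.formA c T (U, V) (WaveST.timeDeriv T U, WaveST.timeDeriv T V) ≥
        1 / (2 * T) * (WaveST.gradNormSqE c T U + WaveST.normSqE T V)) := by
  have hB := WaveST.isCoercive_stiffnessForm hc hd hΩ.measurableSet hΩb hc₀ hcc₀
  exact ⟨fun U V lam χ hUV hlam hχ => WaveST.formA_le hT hc hB hUV hlam hχ,
    fun U V hU hV => WaveST.le_formA_timeDeriv hT hc hU hV⟩
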